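/- Let $m\ge 0$. For $z\in\mathbb{Z}^m$ write $t^z=t_1^{z_1}\cdots t_m^{z_m}$, and for $A\subseteq\mathbb{R}^m$ let $S(A)=\sum_{z\in A\cap\mathbb{Z}^m}t^z$, a formal Laurent series (infinite in all directions allowed). If there is a nonzero Laurent polynomial $\theta\in\mathbb{Z}[t_1^{\pm1},\dots,t_m^{\pm1}]$ such that $\theta S(A)$ is a Laurent polynomial, we say that $\sigma(A)$ is defined and let $\sigma(A)=\frac{\theta S(A)}{\theta}\in\mathbb{Q}(t_1,\dots,t_m)$, which does not depend on the choice of $\theta$. Let $C\subseteq\mathbb{R}^m$ be a rational polyhedral cone with vertex $v$, that is, $C=\{v+\sum_{i=1}^k\alpha_i g_i:\alpha_i\ge 0\}$ with $v,g_1,\dots,g_k\in\mathbb{Q}^m$ ($C$ need be neither full-dimensional nor pointed). An edge of $C$ is a one-dimensional face of $C$. For an edge $u$ let $C_u=\{x+\alpha(y-x): y\in C,\ \alpha\ge 0\}$, where $x$ is any point of the relative interior of $u$; the set $C_u$ does not depend on $x$. Let $\beta\subset\mathbb{R}^m$ be a rational hyperplane, that is, one given by a linear equation with rational coefficients, which contains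 $v$ and contains no point of the relative interior of $C$. Then exactly one of the two closed half-spaces bounded by $\beta$ contains $C$; denote it by $D$. There are only finitely many edges $u$ of $C$ with $u\not\subseteq\beta$, the functions $\sigma(C)$ and $\sigma(C_u\cap D)$ for these $u$ are defined, and $$\sigma(C)=\sum_{u\not\subseteq\beta}\sigma(C_u\cap D),$$ where the sum is over all edges $u$ of $C$ that are not contained in $\beta$. -/

import Mathlib

noncomputable section

namespace RatCone

variable {m : ℕ}

/-- The real point with the given rational coordinates. -/
def ratPoint (q : Fin m → ℚ) : Fin m → ℝ := fun i => (q i : ℝ)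

/-- The real point with the given integer coordinates. -/
def intPoint (z : Fin m → ℤ) : Fin m → ℝ := fun i => (z i : ℝ)

/-- The ring `ℤ[t₁^{±1}, …, t_m^{±1}]`; the monomial `t^z` is `AddMonoidAlgebra.single z 1`. -/
abbrev LaurentPoly (m : ℕ) : Type := AddMonoidAlgebra ℤ (Fin m → ℤ)

/-- The field of rational functions in `t₁, …, t_m`. -/
abbrev RatFun (m : ℕ) : Type := FractionRing (LaurentPoly m)

/-- Formal Laurent series, infinite in all directions, given by their coefficients. -/
abbrev LaurentSer (m : ℕ) : Type := (Fin m → ℤ) → ℤ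

/-- The product of a Laurent polynomial and a formal Laurent series. -/
def act (θ : LaurentPoly m) (F : LaurentSer m) : LaurentSer m :=
  fun z => θ.coeff.sum fun a c => c * F (z - a)

open Classical in
/-- The generating function of the integer points of `A`. -/
def genSeries (A : Set (Fin m → ℝ)) : LaurentSer m :=
  fun z => if intPoint z ∈ A then 1 else 0

/-- `r = p / θ` for a nonzero `θ` such that `θ * S(A)` is the (Laurent) polynomial `p`. -/
def IsSigma (A : Set (Fin m → ℝ)) (r : RatFun m) : Prop :=
  ∃ θ p : LaurentPoly m, θ ≠ 0 ∧ act θ (genSeries A) = ⇑p.coeff ∧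
    r = algebraMap (LaurentPoly m) (RatFun m) p / algebraMap (LaurentPoly m) (RatFun m) θ

/-- The series `S(A)` can be viewed as a rational function. -/
def HasSigma (A : Set (Fin m → ℝ)) : Prop := ∃ r : RatFun m, IsSigma A r

open Classical in
/-- The rational function `σ(A)` defined by the series `S(A)` (`0` if there is none). -/
def sigma (A : Set (Fin m → ℝ)) : RatFun m :=
  if h : HasSigma A then h.choose else 0

theorem act_add (θ θ' : LaurentPoly m) (F : LaurentSer m) :
    act (θ + θ') F = act θ F + act θ' F := by
  funext z
  simp only [act, AddMonoidAlgebra.coeff_add, Pi.add_apply]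
  exact Finsupp.sum_add_index' (by simp) (by intros; ring)

theorem act_zero (F : LaurentSer m) : act 0 F = 0 := by
  funext z
  simp [act]

theorem act_single (a : Fin m → ℤ) (c : ℤ) (F : LaurentSer m) (z : Fin m → ℤ) :
    act (AddMonoidAlgebra.single a c) F z = c * F (z - a) := by
  simp [act]

theorem act_add_right (θ : LaurentPoly m) (F G : LaurentSer m) :
    act θ (F + G) = act θ F + act θ G := by
  funext z
  simp only [act, Pi.add_apply, Finsupp.sum, mul_add, Finset.sum_add_distrib]

theorem act_mul (θ θ' : LaurentPoly m) (F : LaurentSer m) :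
    act (θ * θ') F = act θ (act θ' F) := by
  induction θ using AddMonoidAlgebra.induction_linear with
  | zero => simp [act_zero]
  | add x y hx hy => rw [add_mul, act_add, act_add, hx, hy]
  | single a c =>
    induction θ' using AddMonoidAlgebra.induction_linear with
    | zero => funext z; rw [mul_zero, act_zero, act_single]; simp
    | add x y hx hy => rw [mul_add, act_add, act_add, hx, hy, act_add_right]
    | single b d =>
      funext z
      rw [AddMonoidAlgebra.single_mul_single, act_single, act_single, act_single, sub_sub, mul_assoc]

theorem act_coeff (θ p : LaurentPoly m) : act θ ⇑p.coeff = ⇑(θ * p).coeff := by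
  induction θ using AddMonoidAlgebra.induction_linear with
  | zero => funext z; simp [act_zero]
  | add x y hx hy => rw [act_add, hx, hy, add_mul]; rfl
  | single a c =>
    funext z
    rw [act_single, AddMonoidAlgebra.coeff_single_mul_apply, neg_add_eq_sub]

/-- The rational function does not depend on the choice of `θ`. -/
theorem IsSigma.unique {A : Set (Fin m → ℝ)} {r r' : RatFun m}
    (h : IsSigma A r) (h' : IsSigma A r') : r = r' := by
  obtain ⟨θ, p, hθ, hp, rfl⟩ := h
  obtain ⟨θ', p', hθ', hp', rfl⟩ := h'
  have inj := IsFractionRing.injective (LaurentPoly m) (RatFun m)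
  rw [div_eq_div_iff (by simpa using hθ) (by simpa using hθ'), ← map_mul, ← map_mul]
  congr 1
  have key : act θ' (act θ (genSeries A)) = act θ (act θ' (genSeries A)) := by
    rw [← act_mul, ← act_mul, mul_comm]
  rw [hp, hp', act_coeff, act_coeff] at key
  have := AddMonoidAlgebra.coeff_injective (DFunLike.coe_injective key)
  rw [mul_comm p θ', this, mul_comm]

theorem IsSigma.sigma_eq {A : Set (Fin m → ℝ)} {r : RatFun m} (h : IsSigma A r) :
    sigma A = r := by
  have h' : HasSigma A := ⟨r, h⟩
  rw [sigma, dif_pos h']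
  exact h'.choose_spec.unique h

/-- `C` is a rational polyhedral cone with vertex `v`: the vertex is rational and `C` is the set of
all `v + ∑ α_g g`, `α_g ≥ 0`, for a finite set of rational generators `g`. -/
def IsRationalCone (v : Fin m → ℝ) (C : Set (Fin m → ℝ)) : Prop :=
  (∃ q : Fin m → ℚ, v = ratPoint q) ∧
    ∃ G : Finset (Fin m → ℚ),
      C = {x | ∃ α : (Fin m → ℚ) → ℝ, (∀ g ∈ G, 0 ≤ α g) ∧ x = v + ∑ g ∈ G, α g • ratPoint g}

/-- An edge of `C` is a one-dimensional face, a face being the set of maximum points on `C` of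
some linear functional. -/
def IsEdge (C u : Set (Fin m → ℝ)) : Prop :=
  IsExposed ℝ C u ∧ Module.finrank ℝ (vectorSpan ℝ u) = 1

/-- The cone `C_Γ = {x + α (y - x) | y ∈ C, α ≥ 0}` of `C` at a face `Γ`, where `x` is a point of
the relative interior of `Γ` (all such points give the same set). -/
def coneAt (C Γ : Set (Fin m → ℝ)) : Set (Fin m → ℝ) :=
  {z | ∃ x ∈ intrinsicInterior ℝ Γ, ∃ y ∈ C, ∃ α : ℝ, 0 ≤ α ∧ z = x + α • (y - x)}

/-- `β` is a hyperplane with a rational equation. -/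
def IsRationalHyperplane (β : Set (Fin m → ℝ)) : Prop :=
  ∃ (a : Fin m → ℚ) (b : ℚ), a ≠ 0 ∧ β = {x | ∑ i, (a i : ℝ) * x i = (b : ℝ)}

/-- `D` is one of the two closed half-spaces bounded by the hyperplane `β`. -/
def IsHalfSpaceOf (β D : Set (Fin m → ℝ)) : Prop :=
  ∃ (a : Fin m → ℝ) (b : ℝ), a ≠ 0 ∧ β = {x | ∑ i, a i * x i = b} ∧ D = {x | b ≤ ∑ i, a i * x i}

end RatCone

end

/-! A cone containing a rational line has σ = 0: it is invariant under translation by some nonzero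
integer vector z, so 1 - t^z annihilates its series. For rational a ≠ 0, the cones generated by X ∪
{a} and X ∪ {-a} meet in cone X, and their union is the cone of X ∪ {a, -a}, which contains a line.
Hence the flip identity σ(X) = σ(X ∪ {a}) + σ(X ∪ {-a}), `coneSigma_insert_add_insert_neg`.

Let ℓ be the linear form of β, with its sign chosen so that ℓ ≥ ℓ(v) on C. After rescaling, C - v is
generated by a set Z on which ℓ = 0 and a set P on which ℓ = 1. Flips at differences of elements of
P yield σ(Z ∪ P) = ∑_{d ∈ P} σ({d} ∪ Z ∪ (P - d)), which is `coneSigma_eq_sum`. If d spans an edge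
u, its summand belongs to C_u ∩ D (`coneAt_ray`, `shift_cone_insert_neg_inter`). Otherwise the cone
of the summand contains a line and contributes 0 (`coneSigma_eq_zero_of_not_exposes`). Every edge
outside β comes from exactly one d.

That σ is defined for these cones rests on `isRational_sdiff`: factors 1 - t^g remove the generators
one at a time, and Dickson's lemma preserves finite generation. No triangulation is needed. -/

noncomputable section

namespace RatCone

variable {m : ℕ}

open scoped NNReal

/-! ### Dickson's lemma and finitely generated sets -/

section Dickson

variable {M : Type*} [AddCommGroup M]

/-- `U` is stable under translation by the elements of `G`. -/
def IsStable (G : Set M) (U : Set M) : Prop := ∀ g ∈ G, ∀ u ∈ U, u + g ∈ U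

theorem IsStable.mono {G G' U : Set M} (h : IsStable G U) (hG : G' ⊆ G) : IsStable G' U :=
  fun g hg => h g (hG hg)

theorem IsStable.union {G U V : Set M} (hU : IsStable G U) (hV : IsStable G V) :
    IsStable G (U ∪ V) :=
  fun g hg u hu => hu.imp (hU g hg u) (hV g hg u)

theorem IsStable.inter {G U V : Set M} (hU : IsStable G U) (hV : IsStable G V) :
    IsStable G (U ∩ V) :=
  fun g hg u hu => ⟨hU g hg u hu.1, hV g hg u hu.2⟩

theorem IsStable.translate {G U : Set M} (hU : IsStable G U) (a : M) :
    IsStable G {x | x + a ∈ U} := by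
  intro g hg u hu
  have := hU g hg _ hu
  rwa [add_right_comm] at this

theorem IsStable.add_closure {G U : Set M} (hU : IsStable G U) {u n : M} (hu : u ∈ U)
    (hn : n ∈ AddSubmonoid.closure G) : u + n ∈ U := by
  induction hn using AddSubmonoid.closure_induction generalizing u with
  | mem g hg => exact hU g hg u hu
  | zero => simpa
  | add x y _ _ hx hy => rw [← add_assoc]; exact hy (hx hu)

/-- The set of all `f + n` with `f ∈ F` and `n` in the monoid generated by `G`. -/
def addClosure (F G : Set M) : Set M := {x | ∃ f ∈ F, ∃ n ∈ AddSubmonoid.closure G, x = f + n}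

theorem isStable_addClosure (F G : Set M) : IsStable G (addClosure F G) := by
  rintro g hg _ ⟨f, hf, n, hn, rfl⟩
  exact ⟨f, hf, n + g, add_mem hn (AddSubmonoid.subset_closure hg), by rw [add_assoc]⟩

/-- Dickson's lemma: the minimal elements form an antichain, and antichains in a well-quasi-order
are finite. -/
theorem exists_finite_minimal {ι : Type*} [Finite ι] (T : Set (ι → ℕ)) :
    ∃ B : Set (ι → ℕ), B.Finite ∧ B ⊆ T ∧ ∀ n ∈ T, ∃ k ∈ B, k ≤ n := by
  refine ⟨{n | Minimal (· ∈ T) n},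
    WellQuasiOrderedLE.finite_of_isAntichain (setOfPred_minimal_antichain _),
    fun n hn => hn.1, fun n hn => ?_⟩
  obtain ⟨k, hkn, hk⟩ := exists_minimal_le_of_wellFoundedLT (· ∈ T) n hn
  exact ⟨k, hk, hkn⟩

/-- Any subset of a finitely generated set is finitely generated. -/
theorem exists_finite_generators {G : Finset M} {F U : Set M} (hF : F.Finite)
    (hUF : U ⊆ addClosure F (G : Set M)) :
    ∃ F' : Set M, F'.Finite ∧ F' ⊆ U ∧ U ⊆ addClosure F' G := by
  -- Dickson's lemma is applied to the exponent vectors, separately for each base point f.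
  choose B hBfin hBU hB using fun f : M =>
    exists_finite_minimal {n : G → ℕ | f + ∑ g : G, n g • (g : M) ∈ U}
  refine ⟨⋃ f ∈ F, (fun n : G → ℕ => f + ∑ g : G, n g • (g : M)) '' B f,
    hF.biUnion fun f _ => (hBfin f).image _, ?_, ?_⟩
  · intro x hx
    simp only [Set.mem_iUnion] at hx
    obtain ⟨f, -, n, hn, rfl⟩ := hx
    exact hBU f hn
  · intro x hx
    obtain ⟨f, hf, y, hy, rfl⟩ := hUF hx
    obtain ⟨n, rfl⟩ := AddSubmonoid.mem_closure_finset'.1 hy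
    obtain ⟨k, hk, hkn⟩ := hB f n hx
    refine ⟨f + ∑ g : G, k g • (g : M), ?_, ∑ g : G, (n g - k g) • (g : M), ?_, ?_⟩
    · simp only [Set.mem_iUnion]
      exact ⟨f, hf, k, hk, rfl⟩
    · exact sum_mem fun g _ => nsmul_mem (AddSubmonoid.subset_closure g.2) _
    · rw [add_assoc, ← Finset.sum_add_distrib]
      congr 1
      refine Finset.sum_congr rfl fun g _ => ?_
      rw [← add_nsmul, Nat.add_sub_cancel' (hkn g)]

/-- An element of a finitely generated set outside of `B ⊇ U + g` is generated without `g`. -/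
theorem mem_addClosure_of_not_mem_sub {g : M} {G F U B : Set M} (hU : IsStable (insert g G) U)
    (hFU : F ⊆ U) {x : M} (hx : x ∈ addClosure F (insert g G))
    (hB : ∀ y ∈ U, y + g ∈ B) (hxB : x ∉ B) : x ∈ addClosure F G := by
  obtain ⟨f, hf, n, hn, rfl⟩ := hx
  rw [Set.insert_eq, AddSubmonoid.closure_union, AddSubmonoid.mem_sup] at hn
  obtain ⟨y, hy, z, hz, rfl⟩ := hn
  obtain ⟨k, rfl⟩ := AddSubmonoid.mem_closure_singleton.1 hy
  rcases k with _ | k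
  · exact ⟨f, hf, z, hz, by simp⟩
  -- If g occurs, removing one copy leaves an element of U, so x lies in U + g ⊆ B.
  · refine absurd ?_ hxB
    have h1 : f + (k • g + z) ∈ U := by
      refine hU.add_closure (hFU hf) (add_mem (nsmul_mem ?_ _) ?_)
      · exact AddSubmonoid.subset_closure (Set.mem_insert _ _)
      · exact AddSubmonoid.closure_mono (Set.subset_insert _ _) hz
    convert hB _ h1 using 1
    rw [succ_nsmul]; abel

end Dickson

/-! ### Series that represent rational functions -/

/-- The series `F` becomes a Laurent polynomial after multiplication by some `θ ≠ 0`. -/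
def IsRational (F : LaurentSer m) : Prop :=
  ∃ θ p : LaurentPoly m, θ ≠ 0 ∧ act θ F = ⇑p.coeff

/-- The rational function `r` is defined by the series `F`. -/
def IsSum (F : LaurentSer m) (r : RatFun m) : Prop :=
  ∃ θ p : LaurentPoly m, θ ≠ 0 ∧ act θ F = ⇑p.coeff ∧
    r = algebraMap (LaurentPoly m) (RatFun m) p / algebraMap (LaurentPoly m) (RatFun m) θ

theorem IsRational.isSum {F : LaurentSer m} (h : IsRational F) : ∃ r, IsSum F r := by
  obtain ⟨θ, p, hθ, hp⟩ := h
  exact ⟨_, θ, p, hθ, hp, rfl⟩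

theorem IsSum.isRational {F : LaurentSer m} {r : RatFun m} (h : IsSum F r) : IsRational F := by
  obtain ⟨θ, p, hθ, hp, _⟩ := h
  exact ⟨θ, p, hθ, hp⟩

theorem IsSum.add {F G : LaurentSer m} {r s : RatFun m} (hF : IsSum F r) (hG : IsSum G s) :
    IsSum (F + G) (r + s) := by
  obtain ⟨θ, p, hθ, hp, rfl⟩ := hF
  obtain ⟨η, q, hη, hq, rfl⟩ := hG
  have inj := IsFractionRing.injective (LaurentPoly m) (RatFun m)
  refine ⟨θ * η, η * p + θ * q, mul_ne_zero hθ hη, ?_, ?_⟩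
  · rw [act_add_right, act_mul θ η G, hq, act_coeff, mul_comm θ η, act_mul, hp, act_coeff]
    rfl
  · have h1 : algebraMap (LaurentPoly m) (RatFun m) θ ≠ 0 := by simpa using hθ
    have h2 : algebraMap (LaurentPoly m) (RatFun m) η ≠ 0 := by simpa using hη
    rw [map_add, map_mul, map_mul, map_mul]
    field_simp

theorem IsRational.add {F G : LaurentSer m} (hF : IsRational F) (hG : IsRational G) :
    IsRational (F + G) := by
  obtain ⟨r, hr⟩ := hF.isSum
  obtain ⟨s, hs⟩ := hG.isSum
  exact (hr.add hs).isRational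

theorem IsRational.act {F : LaurentSer m} (hF : IsRational F) (χ : LaurentPoly m) :
    IsRational (act χ F) := by
  obtain ⟨θ, p, hθ, hp⟩ := hF
  exact ⟨θ, χ * p, hθ, by rw [← act_mul, mul_comm, act_mul, hp, act_coeff]⟩

theorem IsRational.of_act {F : LaurentSer m} {χ : LaurentPoly m} (hχ : χ ≠ 0)
    (h : IsRational (RatCone.act χ F)) : IsRational F := by
  obtain ⟨θ, p, hθ, hp⟩ := h
  exact ⟨θ * χ, p, mul_ne_zero hθ hχ, by rw [act_mul, hp]⟩

open Classical in
/-- The generating function of a set of integer vectors. -/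
def indSeries (A : Set (Fin m → ℤ)) : LaurentSer m := fun z => if z ∈ A then 1 else 0

theorem genSeries_eq (A : Set (Fin m → ℝ)) : genSeries A = indSeries (intPoint ⁻¹' A) := rfl

theorem isRational_of_finite {A : Set (Fin m → ℤ)} (hA : A.Finite) :
    IsRational (indSeries A) := by
  refine ⟨1, .ofCoeff (Finsupp.ofSupportFinite (indSeries A) (hA.subset ?_)), one_ne_zero, ?_⟩
  · intro z hz
    by_contra h
    simp [indSeries, h] at hz
  · funext z
    rw [AddMonoidAlgebra.one_def, act_single]
    simp only [one_mul, sub_zero]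
    rfl

/-- The binomial `1 - t^g`. -/
def binom (g : Fin m → ℤ) : LaurentPoly m :=
  AddMonoidAlgebra.single 0 1 + AddMonoidAlgebra.single g (-1)

theorem binom_ne_zero {g : Fin m → ℤ} (hg : g ≠ 0) : binom g ≠ 0 := by
  intro h
  have := congrArg (fun p : LaurentPoly m => p.coeff 0) h
  simp [binom, hg] at this

theorem act_binom (g : Fin m → ℤ) (F : LaurentSer m) (z : Fin m → ℤ) :
    act (binom g) F z = F z - F (z - g) := by
  rw [binom, act_add, Pi.add_apply, act_single, act_single]
  simp
  ring

theorem act_binom_indSeries (g : Fin m → ℤ) (A : Set (Fin m → ℤ)) :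
    act (binom g) (indSeries A) = indSeries {x ∈ A | x - g ∉ A} +
      act (AddMonoidAlgebra.single g (-1)) (indSeries {x ∈ A | x + g ∉ A}) := by
  funext z
  rw [act_binom, Pi.add_apply, act_single]
  simp only [indSeries, Set.mem_ofPred_eq, sub_add_cancel]
  by_cases h1 : z ∈ A <;> by_cases h2 : z - g ∈ A <;> simp [h1, h2]

/-- Differences of stable sets are used because they are closed under the induction: up to a
monomial factor, multiplication by 1 - t^g turns U \ V into the two differences U \ (V ∪ (U + g))
and (U ∩ (V - g)) \ V, both finitely generated without g. -/
theorem isRational_sdiff (G : Finset (Fin m → ℤ)) (hG : 0 ∉ G) (U V F : Set (Fin m → ℤ))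
    (hU : IsStable (G : Set (Fin m → ℤ)) U) (hV : IsStable (G : Set (Fin m → ℤ)) V)
    (hF : F.Finite) (hUV : U \ V ⊆ addClosure F G) : IsRational (indSeries (U \ V)) := by
  classical
  induction G using Finset.induction_on generalizing U V F with
  | empty =>
    refine isRational_of_finite (hF.subset fun x hx => ?_)
    obtain ⟨f, hf, n, hn, rfl⟩ := hUV hx
    simp only [Finset.coe_empty, AddSubmonoid.closure_empty, AddSubmonoid.mem_bot] at hn
    simpa [hn] using hf
  | insert g G hgG ih =>
    have hg : g ≠ 0 := by rintro rfl; simp at hG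
    have hG' : 0 ∉ G := fun h => hG (Finset.mem_insert_of_mem h)
    have hsub : (G : Set (Fin m → ℤ)) ⊆ (insert g G : Finset (Fin m → ℤ)) := by simp
    -- Only U \ V is known to lie in a finitely generated set, so U is cut down to that set first.
    obtain ⟨F₁, hF₁, hF₁U, hUF₁⟩ := exists_finite_generators (G := insert g G)
      (U := U ∩ addClosure F (insert g G : Finset _)) hF Set.inter_subset_right
    obtain ⟨F₂, hF₂, hF₂U, hUF₂⟩ := exists_finite_generators (G := insert g G)
      (U := U ∩ addClosure F (insert g G : Finset _) ∩ {x | x + g ∈ V}) hF (fun x hx => hx.1.2)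
    rw [Finset.coe_insert] at *
    refine IsRational.of_act (binom_ne_zero hg) ?_
    rw [act_binom_indSeries]
    refine IsRational.add ?_ (IsRational.act ?_ _)
    · have h := ih hG' U (V ∪ {x | x + -g ∈ U}) F₁ (hU.mono hsub)
        ((hV.mono hsub).union ((hU.mono hsub).translate _)) hF₁ ?_
      · convert h using 2
        ext x
        simp only [Set.mem_ofPred_eq, Set.mem_sdiff, Set.mem_union, ← sub_eq_add_neg]
        have : x - g ∈ V → x ∈ V := fun h => by simpa using hV g (Set.mem_insert _ _) _ h
        tauto
      · rintro x ⟨hxU, hxV⟩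
        rw [Set.mem_union, not_or] at hxV
        refine mem_addClosure_of_not_mem_sub (hU.inter (isStable_addClosure F _)) hF₁U
          (hUF₁ ⟨hxU, hUV ⟨hxU, hxV.1⟩⟩) (B := {x | x + -g ∈ U}) ?_ hxV.2
        intro y hy
        simpa using hy.1
    · have h := ih hG' (U ∩ {x | x + g ∈ V}) V F₂
        ((hU.mono hsub).inter ((hV.mono hsub).translate _)) (hV.mono hsub) hF₂ ?_
      · convert h using 2
        ext x
        simp only [Set.mem_ofPred_eq, Set.mem_sdiff, Set.mem_inter_iff]
        have : x ∈ U → x + g ∈ U := fun h => hU g (Set.mem_insert _ _) _ h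
        tauto
      · rintro x ⟨⟨hxU, hxg⟩, hxV⟩
        exact mem_addClosure_of_not_mem_sub ((hU.inter (isStable_addClosure F _)).inter
          (hV.translate g)) hF₂U (hUF₂ ⟨⟨hxU, hUV ⟨hxU, hxV⟩⟩, hxg⟩) (B := V)
          (fun y hy => hy.2) hxV

theorem isRational_addClosure {G : Finset (Fin m → ℤ)} (hG : 0 ∉ G) {U F : Set (Fin m → ℤ)}
    (hU : IsStable (G : Set (Fin m → ℤ)) U) (hF : F.Finite) (hUF : U ⊆ addClosure F G) :
    IsRational (indSeries U) := by
  have := isRational_sdiff G hG U ∅ F hU (fun _ _ _ h => h.elim) hF (by simpa using hUF)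
  simpa using this

/-! ### Rational points and the cones they generate -/

theorem ratPoint_add (a b : Fin m → ℚ) : ratPoint (a + b) = ratPoint a + ratPoint b := by
  funext i; simp [ratPoint]

theorem ratPoint_sub (a b : Fin m → ℚ) : ratPoint (a - b) = ratPoint a - ratPoint b := by
  funext i; simp [ratPoint]

theorem ratPoint_neg (a : Fin m → ℚ) : ratPoint (-a) = -ratPoint a := by
  funext i; simp [ratPoint]

theorem ratPoint_smul (c : ℚ) (a : Fin m → ℚ) : ratPoint (c • a) = (c : ℝ) • ratPoint a := by
  funext i; simp [ratPoint]

theorem ratPoint_zero : ratPoint (0 : Fin m → ℚ) = 0 := by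
  funext i; simp [ratPoint]

theorem ratPoint_injective : Function.Injective (ratPoint : (Fin m → ℚ) → Fin m → ℝ) := by
  intro a b h
  funext i
  exact Rat.cast_injective (α := ℝ) (congrFun h i)

theorem intPoint_add (a b : Fin m → ℤ) : intPoint (a + b) = intPoint a + intPoint b := by
  funext i; simp [intPoint]

theorem intPoint_sub (a b : Fin m → ℤ) : intPoint (a - b) = intPoint a - intPoint b := by
  funext i; simp [intPoint]

theorem exists_intPoint_eq_smul (g : Fin m → ℚ) :
    ∃ (n : ℝ) (z : Fin m → ℤ), 0 < n ∧ intPoint z = n • ratPoint g := by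
  refine ⟨∏ i, (g i).den, fun i => (g i).num * ∏ j ∈ Finset.univ.erase i, ((g j).den : ℤ),
    by exact_mod_cast Finset.prod_pos fun i _ => (g i).den_pos, ?_⟩
  funext i
  simp only [intPoint, ratPoint, Pi.smul_apply, smul_eq_mul]
  rw [← Finset.mul_prod_erase _ _ (Finset.mem_univ i)]
  have h : ((g i : ℚ) : ℝ) * ((g i).den : ℝ) = ((g i).num : ℝ) := by
    exact_mod_cast Rat.mul_den_eq_num (g i)
  push_cast
  rw [← h]
  ring

theorem smul_mem_of_nonneg {N : Submodule ℝ≥0 (Fin m → ℝ)} {c : ℝ} (hc : 0 ≤ c)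
    {x : Fin m → ℝ} (hx : x ∈ N) : c • x ∈ N :=
  N.smul_mem ⟨c, hc⟩ hx

/-- The convex cone generated by a set of rational vectors. -/
def cone (X : Set (Fin m → ℚ)) : Submodule ℝ≥0 (Fin m → ℝ) :=
  Submodule.span ℝ≥0 (ratPoint '' X)

/-- The cone `N` moved to the vertex `v`. -/
def shift (v : Fin m → ℝ) (N : Submodule ℝ≥0 (Fin m → ℝ)) : Set (Fin m → ℝ) := {x | x - v ∈ N}

theorem mem_shift {v x : Fin m → ℝ} {N : Submodule ℝ≥0 (Fin m → ℝ)} :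
    x ∈ shift v N ↔ x - v ∈ N := Iff.rfl

theorem mem_cone_of_mem {X : Set (Fin m → ℚ)} {g : Fin m → ℚ} (hg : g ∈ X) :
    ratPoint g ∈ cone X :=
  Submodule.subset_span ⟨g, hg, rfl⟩

theorem cone_le {X : Set (Fin m → ℚ)} {N : Submodule ℝ≥0 (Fin m → ℝ)} :
    cone X ≤ N ↔ ∀ g ∈ X, ratPoint g ∈ N := by
  rw [cone, Submodule.span_le, Set.image_subset_iff]
  rfl

theorem cone_mono {X Y : Set (Fin m → ℚ)} (h : X ⊆ Y) : cone X ≤ cone Y :=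
  cone_le.2 fun _ hg => mem_cone_of_mem (h hg)

theorem mem_cone_insert {X : Set (Fin m → ℚ)} {a : Fin m → ℚ} {x : Fin m → ℝ} :
    x ∈ cone (insert a X) ↔ ∃ c : ℝ, 0 ≤ c ∧ ∃ n ∈ cone X, x = c • ratPoint a + n := by
  rw [cone, Set.image_insert_eq, Submodule.mem_span_insert]
  constructor
  · rintro ⟨c, n, hn, rfl⟩
    exact ⟨c, c.2, n, hn, rfl⟩
  · rintro ⟨c, hc, n, hn, rfl⟩
    exact ⟨⟨c, hc⟩, n, hn, rfl⟩

theorem mem_span_image_finset {ι : Type*} (f : ι → Fin m → ℝ) (G : Finset ι) {x : Fin m → ℝ} :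
    x ∈ Submodule.span ℝ≥0 (f '' G) ↔
      ∃ α : ι → ℝ, (∀ g ∈ G, 0 ≤ α g) ∧ x = ∑ g ∈ G, α g • f g := by
  rw [Submodule.mem_span_image_finset_iff_exists_fun']
  constructor
  · rintro ⟨c, rfl⟩
    exact ⟨fun g => c g, fun g _ => (c g).2, rfl⟩
  · rintro ⟨α, hα, rfl⟩
    refine ⟨fun g => (α g).toNNReal, Finset.sum_congr rfl fun g hg => ?_⟩
    rw [NNReal.smul_def, Real.coe_toNNReal _ (hα g hg)]

theorem mem_of_mem_insert_of_mem_insert_neg {X : Set (Fin m → ℚ)} {a : Fin m → ℚ}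
    {x : Fin m → ℝ} (h : x ∈ cone (insert a X)) (h' : x ∈ cone (insert (-a) X)) :
    x ∈ cone X := by
  obtain ⟨c, hc, n, hn, h⟩ := mem_cone_insert.1 h
  obtain ⟨d, hd, k, hk, h'⟩ := mem_cone_insert.1 h'
  rcases hc.eq_or_lt with rfl | hc'
  · simpa [h] using hn
  · have hcd : 0 < c + d := by linarith
    -- With x = c a + n = -d a + k, the weights d and c cancel the multiples of a.
    have hx : x = (d / (c + d)) • n + (c / (c + d)) • k := by
      have h1 : (c + d) • x = d • n + c • k := by
        rw [add_smul]
        nth_rewrite 1 [h']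
        rw [h, ratPoint_neg]
        module
      rw [← one_smul ℝ x, ← div_self hcd.ne', div_eq_inv_mul, mul_smul, h1]
      module
    rw [hx]
    exact add_mem (smul_mem_of_nonneg (by positivity) hn) (smul_mem_of_nonneg (by positivity) hk)

theorem mem_insert_or_mem_insert_neg {X : Set (Fin m → ℚ)} {a : Fin m → ℚ}
    {x : Fin m → ℝ} (h : x ∈ cone (insert a (insert (-a) X))) :
    x ∈ cone (insert a X) ∨ x ∈ cone (insert (-a) X) := by
  obtain ⟨c, hc, _, hn, rfl⟩ := mem_cone_insert.1 h
  obtain ⟨d, hd, n, hn', rfl⟩ := mem_cone_insert.1 hn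
  rw [mem_cone_insert, mem_cone_insert]
  rcases le_total d c with hcd | hcd
  · exact .inl ⟨c - d, by linarith, n, hn', by rw [ratPoint_neg]; module⟩
  · exact .inr ⟨d - c, by linarith, n, hn', by rw [ratPoint_neg]; module⟩

/-! ### Rational functions of cones and the flip identity -/

theorem genSeries_of_mem {A : Set (Fin m → ℝ)} {z : Fin m → ℤ} (h : intPoint z ∈ A) :
    genSeries A z = 1 := if_pos h

theorem genSeries_of_notMem {A : Set (Fin m → ℝ)} {z : Fin m → ℤ} (h : intPoint z ∉ A) :
    genSeries A z = 0 := if_neg h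

theorem genSeries_insert_add_insert_neg (v : Fin m → ℝ) (X : Set (Fin m → ℚ)) (a : Fin m → ℚ) :
    genSeries (shift v (cone (insert a X))) + genSeries (shift v (cone (insert (-a) X))) =
      genSeries (shift v (cone X)) + genSeries (shift v (cone (insert a (insert (-a) X)))) := by
  funext z
  simp only [Pi.add_apply]
  have h1 := @mem_of_mem_insert_of_mem_insert_neg m X a (intPoint z - v)
  have h2 := @mem_insert_or_mem_insert_neg m X a (intPoint z - v)
  have hs : ∀ {Y W : Set (Fin m → ℚ)}, Y ⊆ W → shift v (cone Y) ⊆ shift v (cone W) :=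
    fun h _ hx => cone_mono h hx
  have h3 : shift v (cone X) ⊆ shift v (cone (insert a X)) := hs (Set.subset_insert _ _)
  have h4 : shift v (cone X) ⊆ shift v (cone (insert (-a) X)) := hs (Set.subset_insert _ _)
  have h5 : shift v (cone (insert a X)) ⊆ shift v (cone (insert a (insert (-a) X))) :=
    hs (Set.insert_subset_insert (Set.subset_insert _ _))
  have h6 : shift v (cone (insert (-a) X)) ⊆ shift v (cone (insert a (insert (-a) X))) :=
    hs (Set.subset_insert _ _)
  by_cases e1 : intPoint z ∈ shift v (cone (insert a X))
  · by_cases e2 : intPoint z ∈ shift v (cone (insert (-a) X))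
    · have e3 : intPoint z ∈ shift v (cone X) := h1 e1 e2
      rw [genSeries_of_mem e1, genSeries_of_mem e2, genSeries_of_mem e3,
        genSeries_of_mem (h5 e1)]
    · have e3 : intPoint z - v ∉ cone X := fun h => e2 (h4 h)
      rw [genSeries_of_mem e1, genSeries_of_notMem e2, genSeries_of_notMem e3,
        genSeries_of_mem (h5 e1), add_comm]
  · have e3 : intPoint z - v ∉ cone X := fun h => e1 (h3 h)
    by_cases e2 : intPoint z ∈ shift v (cone (insert (-a) X))
    · rw [genSeries_of_notMem e1, genSeries_of_mem e2, genSeries_of_notMem e3,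
        genSeries_of_mem (h6 e2)]
    · have e4 : intPoint z - v ∉ cone (insert a (insert (-a) X)) :=
        fun h => (h2 h).elim e1 e2
      rw [genSeries_of_notMem e1, genSeries_of_notMem e2, genSeries_of_notMem e3,
        genSeries_of_notMem e4]

theorem isSigma_zero_of_line {v : Fin m → ℝ} {N : Submodule ℝ≥0 (Fin m → ℝ)} {a : Fin m → ℚ}
    (ha : a ≠ 0) (h : ratPoint a ∈ N) (h' : -ratPoint a ∈ N) : IsSigma (shift v N) 0 := by
  obtain ⟨n, z, hn, hz⟩ := exists_intPoint_eq_smul a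
  have hz0 : z ≠ 0 := by
    rintro rfl
    have h0 : n • ratPoint a = 0 := by rw [← hz]; funext i; simp [intPoint]
    rw [smul_eq_zero, or_iff_right hn.ne', ← ratPoint_zero] at h0
    exact ha (ratPoint_injective h0)
  refine ⟨binom z, 0, binom_ne_zero hz0, ?_, by simp⟩
  funext y
  rw [act_binom]
  have key : intPoint (y - z) ∈ shift v N ↔ intPoint y ∈ shift v N := by
    rw [mem_shift, mem_shift, intPoint_sub, hz]
    constructor <;> intro hy
    · convert add_mem hy (smul_mem_of_nonneg hn.le h) using 1; abel
    · convert add_mem hy (smul_mem_of_nonneg hn.le h') using 1; rw [smul_neg]; abel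
  by_cases hy : intPoint y ∈ shift v N
  · rw [genSeries_of_mem hy, genSeries_of_mem (key.2 hy)]
    rfl
  · rw [genSeries_of_notMem hy, genSeries_of_notMem (fun h => hy (key.1 h))]
    rfl

/-- Splitting coefficients into integer and fractional parts shows that the lattice points of the
cone are generated from those in a bounded parallelepiped. The generators may be dependent, since
only a covering is needed, not unique representations. -/
theorem isRational_shift_intPoint (v : Fin m → ℝ) {G : Finset (Fin m → ℤ)} (hG : 0 ∉ G) :
    IsRational (genSeries (shift v (Submodule.span ℝ≥0 (intPoint '' (G : Set (Fin m → ℤ)))))) := by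
  rw [genSeries_eq]
  refine isRational_addClosure hG (F := {z | ∃ α : (Fin m → ℤ) → ℝ,
    (∀ g ∈ G, 0 ≤ α g ∧ α g ≤ 1) ∧ intPoint z = v + ∑ g ∈ G, α g • intPoint g}) ?_ ?_ ?_
  · intro g hg u hu
    rw [Set.mem_preimage, mem_shift, intPoint_add, add_sub_right_comm]
    exact add_mem hu (Submodule.subset_span ⟨g, hg, rfl⟩)
  · refine (Set.finite_Icc (fun i => ⌊v i - ∑ g ∈ G, |(g i : ℝ)|⌋)
      (fun i => ⌈v i + ∑ g ∈ G, |(g i : ℝ)|⌉)).subset ?_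
    rintro z ⟨α, hα, hz⟩
    have hz' : ∀ i, (z i : ℝ) = v i + ∑ g ∈ G, α g * g i := fun i => by
      have := congrFun hz i
      simpa [intPoint] using this
    have hb : ∀ i, |∑ g ∈ G, α g * (g i : ℝ)| ≤ ∑ g ∈ G, |(g i : ℝ)| := fun i => by
      refine (Finset.abs_sum_le_sum_abs _ _).trans (Finset.sum_le_sum fun g hg => ?_)
      rw [abs_mul, abs_of_nonneg (hα g hg).1]
      exact mul_le_of_le_one_left (abs_nonneg _) (hα g hg).2
    rw [Set.mem_Icc, Pi.le_def, Pi.le_def]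
    refine ⟨fun i => ?_, fun i => ?_⟩
    · have := (abs_le.1 (hb i)).1
      rw [← Int.cast_le (R := ℝ)]
      refine (Int.floor_le _).trans ?_
      rw [hz' i]; linarith
    · have := (abs_le.1 (hb i)).2
      rw [← Int.cast_le (R := ℝ)]
      refine le_trans ?_ (Int.le_ceil _)
      rw [hz' i]; linarith
  · intro z hz
    rw [Set.mem_preimage, mem_shift, mem_span_image_finset] at hz
    obtain ⟨α, hα, hz⟩ := hz
    refine ⟨z - ∑ g ∈ G, ⌊α g⌋₊ • g, ⟨fun g => α g - ⌊α g⌋₊, fun g hg => ⟨?_, ?_⟩, ?_⟩,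
      ∑ g ∈ G, ⌊α g⌋₊ • g, ?_, by abel⟩
    · have := Nat.floor_le (hα g hg)
      linarith
    · have := Nat.lt_floor_add_one (α g)
      linarith
    · rw [sub_eq_iff_eq_add] at hz
      rw [intPoint_sub, hz]
      simp only [sub_smul, Finset.sum_sub_distrib]
      have : intPoint (∑ g ∈ G, ⌊α g⌋₊ • g) = ∑ g ∈ G, (⌊α g⌋₊ : ℝ) • intPoint g := by
        funext i
        simp [intPoint, Finset.sum_apply]
      rw [this]
      abel
    · exact sum_mem fun g hg => nsmul_mem (AddSubmonoid.subset_closure hg) _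

theorem hasSigma_cone (v : Fin m → ℝ) {X : Set (Fin m → ℚ)} (hX : X.Finite) :
    HasSigma (shift v (cone X)) := by
  classical
  choose n z hn hz using fun g : Fin m → ℚ => exists_intPoint_eq_smul g
  -- Denominators are cleared, and 0 is discarded because 1 - t^0 = 0 cannot serve as a denominator.
  have key : cone X = Submodule.span ℝ≥0
      (intPoint '' (((hX.toFinset.image z).erase 0 : Finset (Fin m → ℤ)) : Set (Fin m → ℤ))) := by
    apply le_antisymm
    · refine cone_le.2 fun g hg => ?_
      have : ratPoint g = (n g)⁻¹ • intPoint (z g) := by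
        rw [hz, inv_smul_smul₀ (hn g).ne']
      rw [this]
      refine smul_mem_of_nonneg (inv_nonneg.2 (hn g).le) ?_
      by_cases h0 : z g = 0
      · have : intPoint (z g) = 0 := by rw [h0]; funext i; simp [intPoint]
        rw [this]
        exact zero_mem _
      · refine Submodule.subset_span ⟨z g, ?_, rfl⟩
        simp only [Finset.coe_erase, Finset.coe_image, Set.Finite.coe_toFinset]
        exact ⟨⟨g, hg, rfl⟩, h0⟩
    · rw [Submodule.span_le]
      rintro _ ⟨w, hw, rfl⟩
      simp only [Finset.coe_erase, Finset.coe_image, Set.Finite.coe_toFinset] at hw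
      obtain ⟨⟨g, hg, rfl⟩, -⟩ := hw
      rw [hz]
      exact smul_mem_of_nonneg (hn g).le (mem_cone_of_mem hg)
  rw [key]
  exact (isRational_shift_intPoint v (Finset.notMem_erase _ _)).isSum

/-- The rational function of the cone with vertex `v` generated by `X`. -/
def coneSigma (v : Fin m → ℝ) (X : Set (Fin m → ℚ)) : RatFun m := sigma (shift v (cone X))

theorem isSigma_sigma {A : Set (Fin m → ℝ)} (h : HasSigma A) : IsSigma A (sigma A) := by
  obtain ⟨r, hr⟩ := h
  rwa [hr.sigma_eq]

theorem coneSigma_eq_zero {v : Fin m → ℝ} {X : Set (Fin m → ℚ)} {a : Fin m → ℚ}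
    (ha : a ≠ 0) (h : ratPoint a ∈ cone X) (h' : -ratPoint a ∈ cone X) : coneSigma v X = 0 :=
  (isSigma_zero_of_line ha h h').sigma_eq

theorem coneSigma_insert_add_insert_neg (v : Fin m → ℝ) {X : Set (Fin m → ℚ)} (hX : X.Finite)
    {a : Fin m → ℚ} (ha : a ≠ 0) :
    coneSigma v (insert a X) + coneSigma v (insert (-a) X) = coneSigma v X := by
  have h1 : IsSum _ _ := isSigma_sigma (hasSigma_cone v (hX.insert a))
  have h2 : IsSum _ _ := isSigma_sigma (hasSigma_cone v (hX.insert (-a)))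
  -- `IsSigma A` unfolds to `IsSum (genSeries A)`; the union term contains the line through a, so it
  -- contributes 0.
  have h3 : IsSum (genSeries (shift v (cone (insert a (insert (-a) X))))) 0 := by
    refine isSigma_zero_of_line ha (mem_cone_of_mem (by simp)) ?_
    rw [← ratPoint_neg]
    exact mem_cone_of_mem (by simp)
  have h4 : IsSum (-genSeries (shift v (cone (insert a (insert (-a) X))))) 0 := by
    obtain ⟨θ, p, hθ, hp, hr⟩ := h3
    refine ⟨θ, -p, hθ, ?_, by rw [map_neg, neg_div, ← hr, neg_zero]⟩
    funext z
    have := congrFun hp z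
    simp only [act, Finsupp.sum, Pi.neg_apply, mul_neg, Finset.sum_neg_distrib] at this ⊢
    rw [this]
    rfl
  have h5 := (h1.add h2).add h4
  rw [genSeries_insert_add_insert_neg, add_neg_cancel_right, add_zero] at h5
  exact (IsSigma.sigma_eq h5).symm

theorem coneSigma_congr {v : Fin m → ℝ} {X Y : Set (Fin m → ℚ)}
    (hXY : ∀ g ∈ X, ratPoint g ∈ cone Y) (hYX : ∀ g ∈ Y, ratPoint g ∈ cone X) :
    coneSigma v X = coneSigma v Y := by
  rw [coneSigma, coneSigma, le_antisymm (cone_le.2 hXY) (cone_le.2 hYX)]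

/-- A generator that is a sum of two elements of the cone is superfluous. -/
theorem coneSigma_insert_eq {v : Fin m → ℝ} {X Y : Set (Fin m → ℚ)} {a b c : Fin m → ℚ}
    (hY : Y ⊆ X) (hX : X ⊆ insert c Y) (ha : a ∈ Y) (hc : c = a + b) :
    coneSigma v (insert b X) = coneSigma v (insert b Y) := by
  refine coneSigma_congr (fun g hg => ?_) fun g hg =>
    mem_cone_of_mem (Set.insert_subset_insert hY hg)
  rcases hg with rfl | hg
  · exact mem_cone_of_mem (Set.mem_insert _ _)
  · rcases hX hg with rfl | hg
    · rw [hc, ratPoint_add]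
      exact add_mem (mem_cone_of_mem (Set.mem_insert_of_mem _ ha))
        (mem_cone_of_mem (Set.mem_insert _ _))
    · exact mem_cone_of_mem (Set.mem_insert_of_mem _ hg)

/-- Induction on |P|. A flip at b - a makes b superfluous in one cone and a in the other, so both
have a smaller P. In the two resulting sums, the terms for d = a and d = b are already final; the
terms for any other d recombine by the same flip read backwards. -/
theorem coneSigma_eq_sum (v : Fin m → ℝ) (P : Finset (Fin m → ℚ)) (hP : P.Nonempty)
    (Z : Set (Fin m → ℚ)) (hZ : Z.Finite) :
    coneSigma v (Z ∪ P) =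
      ∑ d ∈ P, coneSigma v (insert d (Z ∪ (fun g => g - d) '' (P : Set (Fin m → ℚ)))) := by
  classical
  induction hn : P.card using Nat.strong_induction_on generalizing P Z with
  | _ n ih =>
  subst hn
  obtain ⟨a, ha⟩ := hP
  by_cases hab : ∃ b ∈ P, b ≠ a
  · obtain ⟨b, hb, hab⟩ := hab
    have hfin : (Z ∪ (P : Set (Fin m → ℚ))).Finite := hZ.union P.finite_toSet
    have hb' : b ∈ P.erase a := Finset.mem_erase.2 ⟨hab, hb⟩
    have ha' : a ∈ P.erase b := Finset.mem_erase.2 ⟨hab.symm, ha⟩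
    have e1 : coneSigma v (insert (b - a) (Z ∪ P)) =
        coneSigma v (insert (b - a) Z ∪ (P.erase b : Finset _)) := by
      rw [Set.insert_union]
      refine coneSigma_insert_eq (a := a) (c := b) ?_ ?_ (.inr ha') (by abel)
      · exact Set.union_subset_union_right _ (by simp)
      · intro x hx
        simp only [Set.mem_insert_iff, Set.mem_union, Finset.mem_coe, Finset.mem_erase] at hx ⊢
        tauto
    have e2 : coneSigma v (insert (a - b) (Z ∪ P)) =
        coneSigma v (insert (a - b) Z ∪ (P.erase a : Finset _)) := by
      rw [Set.insert_union]
      refine coneSigma_insert_eq (a := b) (c := a) ?_ ?_ (.inr hb') (by abel)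
      · exact Set.union_subset_union_right _ (by simp)
      · intro x hx
        simp only [Set.mem_insert_iff, Set.mem_union, Finset.mem_coe, Finset.mem_erase] at hx ⊢
        tauto
    have flip := coneSigma_insert_add_insert_neg v hfin (sub_ne_zero.2 hab)
    rw [neg_sub, e1, e2, ih _ (Finset.card_erase_lt_of_mem hb) _ ⟨a, ha'⟩ _ (hZ.insert _) rfl,
      ih _ (Finset.card_erase_lt_of_mem ha) _ ⟨b, hb'⟩ _ (hZ.insert _) rfl,
      ← Finset.add_sum_erase _ _ ha', ← Finset.add_sum_erase _ _ hb',
      Finset.erase_right_comm] at flip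
    rw [← flip, ← Finset.add_sum_erase _ _ ha, ← Finset.add_sum_erase _ _ hb',
      Finset.erase_right_comm]
    -- The flipped vector e - d is exactly the one missing from (P \ {e}) - d.
    have t1 : ∀ d e : Fin m → ℚ, d ∈ P → e ∈ P →
        insert d (insert (e - d) Z ∪ (fun g => g - d) '' ((P.erase e : Finset _) : Set (Fin m → ℚ)))
          = insert d (Z ∪ (fun g => g - d) '' (P : Set (Fin m → ℚ))) := by
      intro d e hd he
      conv_rhs => rw [← Finset.insert_erase he, Finset.coe_insert, Set.image_insert_eq,
        Set.union_insert]
      rw [Set.insert_union]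
    -- Here b - d = (b - a) + (a - d) may be restored as a generator, and symmetrically a - d.
    have t2 : ∀ d ∈ (P.erase b).erase a,
        coneSigma v (insert d (insert (b - a) Z ∪ (fun g => g - d) '' (P.erase b : Finset _))) +
        coneSigma v (insert d (insert (a - b) Z ∪ (fun g => g - d) '' (P.erase a : Finset _))) =
        coneSigma v (insert d (Z ∪ (fun g => g - d) '' (P : Set (Fin m → ℚ)))) := by
      intro d hd
      have hfin' : (insert d (Z ∪ (fun g => g - d) '' (P : Set (Fin m → ℚ)))).Finite :=
        (hZ.union (P.finite_toSet.image _)).insert _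
      rw [← coneSigma_insert_add_insert_neg v hfin' (sub_ne_zero.2 hab), neg_sub]
      congr 1
      · rw [Set.insert_union, Set.insert_comm]
        refine (coneSigma_insert_eq (a := a - d) (c := b - d) ?_ ?_ ?_ (by abel)).symm
        · exact Set.insert_subset_insert (Set.union_subset_union_right _
            (Set.image_mono (by simp)))
        · rintro x (rfl | hx | ⟨g, hg, rfl⟩)
          · simp
          · exact .inr (.inr (.inl hx))
          · by_cases hgb : g = b
            · exact .inl (by rw [hgb])
            · exact .inr (.inr (.inr ⟨g, Finset.mem_erase.2 ⟨hgb, hg⟩, rfl⟩))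
        · exact .inr (.inr ⟨a, ha', rfl⟩)
      · rw [Set.insert_union, Set.insert_comm]
        refine (coneSigma_insert_eq (a := b - d) (c := a - d) ?_ ?_ ?_ (by abel)).symm
        · exact Set.insert_subset_insert (Set.union_subset_union_right _
            (Set.image_mono (by simp)))
        · rintro x (rfl | hx | ⟨g, hg, rfl⟩)
          · simp
          · exact .inr (.inr (.inl hx))
          · by_cases hgb : g = a
            · exact .inl (by rw [hgb])
            · exact .inr (.inr (.inr ⟨g, Finset.mem_erase.2 ⟨hgb, hg⟩, rfl⟩))
        · exact .inr (.inr ⟨b, hb', rfl⟩)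
    rw [t1 a b ha hb, t1 b a hb ha, ← Finset.sum_congr rfl t2, Finset.sum_add_distrib]
    ring
  · have hPa : P = {a} := by
      refine Finset.eq_singleton_iff_unique_mem.2 ⟨ha, fun b hb => ?_⟩
      by_contra h
      exact hab ⟨b, hb, h⟩
    subst hPa
    rw [Finset.sum_singleton]
    refine coneSigma_congr ?_ ?_
    · rintro g (hg | hg)
      · exact mem_cone_of_mem (.inr (.inl hg))
      · exact mem_cone_of_mem (.inl (by simpa using hg))
    · rintro g (rfl | hg | hg)
      · exact mem_cone_of_mem (.inr (by simp))
      · exact mem_cone_of_mem (.inl hg)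
      · have : g = 0 := by simpa using hg
        rw [this, ratPoint_zero]
        exact zero_mem _

/-! ### Segments and the relative interior -/

section RelativeInterior

variable {E : Type*} [NormedAddCommGroup E] [NormedSpace ℝ E] {A : Set E} {x y : E}

theorem mem_intrinsicInterior_iff_dist : x ∈ intrinsicInterior ℝ A ↔
    x ∈ affineSpan ℝ A ∧ ∃ ε > 0, ∀ w ∈ affineSpan ℝ A, dist w x < ε → w ∈ A := by
  rw [mem_intrinsicInterior]
  constructor
  · rintro ⟨x, hx, rfl⟩
    obtain ⟨ε, hε, h⟩ := Metric.mem_nhds_iff.1 (mem_interior_iff_mem_nhds.1 hx)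
    exact ⟨x.2, ε, hε, fun w hw hwx => @h ⟨w, hw⟩ hwx⟩
  · rintro ⟨hx, ε, hε, h⟩
    exact ⟨⟨x, hx⟩, mem_interior_iff_mem_nhds.2
      (Metric.mem_nhds_iff.2 ⟨ε, hε, fun w hw => h w w.2 hw⟩), rfl⟩

/-- Segments in `A` ending at a relative interior point can be prolonged beyond that point. -/
theorem exists_add_smul_sub_mem (hx : x ∈ intrinsicInterior ℝ A) (hy : y ∈ A) :
    ∃ ε : ℝ, 0 < ε ∧ x + ε • (x - y) ∈ A := by
  obtain ⟨hxA, ε, hε, h⟩ := mem_intrinsicInterior_iff_dist.1 hx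
  have hn : 0 < ‖x - y‖ + 1 := by positivity
  refine ⟨ε / (‖x - y‖ + 1), by positivity, h _ ?_ ?_⟩
  · have := AffineMap.lineMap_mem (1 + ε / (‖x - y‖ + 1)) (subset_affineSpan ℝ A hy) hxA
    convert this using 1
    rw [AffineMap.lineMap_apply, vsub_eq_sub, vadd_eq_add]
    module
  · rw [dist_eq_norm, add_sub_cancel_left, norm_smul, Real.norm_of_nonneg (by positivity),
      div_mul_eq_mul_div, div_lt_iff₀ hn]
    nlinarith

theorem lineMap_mem_intrinsicInterior (hA : Convex ℝ A) (hx : x ∈ intrinsicInterior ℝ A)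
    (hy : y ∈ A) {t : ℝ} (ht : 0 ≤ t) (ht' : t < 1) :
    AffineMap.lineMap x y t ∈ intrinsicInterior ℝ A := by
  obtain ⟨hxA, ε, hε, h⟩ := mem_intrinsicInterior_iff_dist.1 hx
  have h1t : 0 < 1 - t := by linarith
  refine mem_intrinsicInterior_iff_dist.2 ⟨AffineMap.lineMap_mem t hxA (subset_affineSpan ℝ A hy),
    ε * (1 - t), by positivity, fun w hw hwx => ?_⟩
  -- The homothety with centre y and ratio 1/(1 - t) carries w close to x, hence into A.
  have h1 : AffineMap.lineMap y w (1 - t)⁻¹ ∈ A := by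
    refine h _ (AffineMap.lineMap_mem _ (subset_affineSpan ℝ A hy) hw) ?_
    have h2 : AffineMap.lineMap y w (1 - t)⁻¹ - x =
        (1 - t)⁻¹ • (w - AffineMap.lineMap x y t) := by
      rw [eq_inv_smul_iff₀ h1t.ne', AffineMap.lineMap_apply, AffineMap.lineMap_apply]
      simp only [vsub_eq_sub, vadd_eq_add, smul_sub, smul_add, smul_inv_smul₀ h1t.ne']
      module
    rw [dist_eq_norm] at hwx ⊢
    rw [h2, norm_smul, Real.norm_of_nonneg (by positivity), inv_mul_lt_iff₀ h1t, mul_comm]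
    exact hwx
  have h3 := hA h1 hy h1t.le ht (by ring)
  convert h3 using 1
  rw [AffineMap.lineMap_apply]
  simp only [vsub_eq_sub, vadd_eq_add, smul_sub, smul_add, smul_inv_smul₀ h1t.ne']
  module

/-- Otherwise the segment from x to y would cross the level b at a relative interior point. -/
theorem le_of_disjoint_intrinsicInterior (hA : Convex ℝ A) (f : E →ₗ[ℝ] ℝ) {b : ℝ}
    (h : Disjoint {x | f x = b} (intrinsicInterior ℝ A)) (hx : x ∈ intrinsicInterior ℝ A)
    (hb : b < f x) (hy : y ∈ A) : b ≤ f y := by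
  by_contra! hlt
  have h1 : 0 < f x - f y := by linarith
  refine Set.disjoint_left.1 h ?_ (lineMap_mem_intrinsicInterior hA hx hy
    (t := (f x - b) / (f x - f y)) (div_nonneg (by linarith) h1.le)
      ((div_lt_one h1).2 (by linarith)))
  rw [Set.mem_ofPred_eq, AffineMap.lineMap_apply, vsub_eq_sub, vadd_eq_add, map_add, map_smul,
    map_sub, smul_eq_mul]
  field_simp
  ring

end RelativeInterior

/-! ### Rays, the cones at them, and exposing functionals -/

theorem convex_shift (v : Fin m → ℝ) (N : Submodule ℝ≥0 (Fin m → ℝ)) :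
    Convex ℝ (shift v N) := by
  intro x hx y hy a b ha hb hab
  rw [mem_shift] at *
  have : a • x + b • y - v = a • (x - v) + b • (y - v) := by
    rw [smul_sub, smul_sub, sub_add_sub_comm, ← add_smul, hab, one_smul]
  rw [this]
  exact add_mem (smul_mem_of_nonneg ha hx) (smul_mem_of_nonneg hb hy)

theorem self_mem_shift (v : Fin m → ℝ) (N : Submodule ℝ≥0 (Fin m → ℝ)) : v ∈ shift v N := by
  rw [mem_shift, sub_self]
  exact zero_mem _

/-- The ray from `v` in the direction `d`. -/
def ray (v : Fin m → ℝ) (d : Fin m → ℚ) : Set (Fin m → ℝ) :=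
  {x | ∃ t : ℝ, 0 ≤ t ∧ x = v + t • ratPoint d}

theorem convex_ray (v : Fin m → ℝ) (d : Fin m → ℚ) : Convex ℝ (ray v d) := by
  rintro _ ⟨s, hs, rfl⟩ _ ⟨t, ht, rfl⟩ a b ha hb hab
  refine ⟨a * s + b * t, by positivity, ?_⟩
  nth_rewrite 3 [← one_smul ℝ v]
  rw [← hab]
  module

theorem coneAt_ray (v : Fin m → ℝ) {X : Set (Fin m → ℚ)} {d : Fin m → ℚ} (hd : d ∈ X)
    (hd0 : d ≠ 0) : coneAt (shift v (cone X)) (ray v d) = shift v (cone (insert (-d) X)) := by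
  have hd0' : ratPoint d ≠ 0 := by
    rw [← ratPoint_zero]
    exact ratPoint_injective.ne hd0
  have hv : v ∈ ray v d := ⟨0, le_rfl, by simp⟩
  -- The endpoint v is not in the relative interior: the segment from v + d to v cannot be prolonged
  -- within the ray.
  have hpos : ∀ x ∈ intrinsicInterior ℝ (ray v d), ∃ t : ℝ, 0 < t ∧ x = v + t • ratPoint d := by
    intro x hx
    obtain ⟨t, ht, rfl⟩ := intrinsicInterior_subset hx
    rcases ht.eq_or_lt with rfl | ht
    · exfalso
      obtain ⟨ε, hε, s, hs, h⟩ := exists_add_smul_sub_mem hx (y := v + (1 : ℝ) • ratPoint d)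
        ⟨1, zero_le_one, rfl⟩
      have h1 : (s + ε) • ratPoint d = 0 := by
        have h2 : (v + (0 : ℝ) • ratPoint d + ε • (v + (0 : ℝ) • ratPoint d -
          (v + (1 : ℝ) • ratPoint d))) - v = -(ε • ratPoint d) := by module
        rw [h] at h2
        rw [add_smul, ← sub_eq_zero.2 h2]
        module
      rw [smul_eq_zero, or_iff_left hd0'] at h1
      linarith
    · exact ⟨t, ht, rfl⟩
  ext z
  constructor
  · rintro ⟨x, hx, y, hy, α, hα, rfl⟩
    obtain ⟨t, ht, rfl⟩ := hpos x hx
    rw [mem_shift] at hy ⊢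
    have h1 : v + t • ratPoint d + α • (y - (v + t • ratPoint d)) - v =
        t • ratPoint d + (α • (y - v) + (α * t) • ratPoint (-d)) := by
      rw [ratPoint_neg]
      module
    rw [h1]
    refine add_mem (smul_mem_of_nonneg ht.le (mem_cone_of_mem (.inr hd)))
      (add_mem (smul_mem_of_nonneg hα (cone_mono (Set.subset_insert _ _) hy))
        (smul_mem_of_nonneg (by positivity) (mem_cone_of_mem (.inl rfl))))
  · intro hz
    obtain ⟨s, hs, n, hn, hz⟩ := mem_cone_insert.1 (mem_shift.1 hz)
    obtain ⟨x, hx⟩ := Set.Nonempty.intrinsicInterior (convex_ray v d) ⟨v, hv⟩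
    obtain ⟨t, ht, rfl⟩ := hpos x hx
    have hst : 0 < s + t := by linarith
    -- The factor α = (s + t)/t turns the contribution t d of x into -s d; the scaling of n
    -- compensates for α.
    refine ⟨_, hx, v + (t / (s + t)) • n, ?_, (s + t) / t, by positivity, ?_⟩
    · rw [mem_shift, add_sub_cancel_left]
      exact smul_mem_of_nonneg (by positivity) hn
    · rw [sub_eq_iff_eq_add] at hz
      have h1 : ((s + t) / t) • (v + (t / (s + t)) • n - (v + t • ratPoint d)) =
          n - (s + t) • ratPoint d := by
        rw [add_sub_add_left_eq_sub, smul_sub, smul_smul, smul_smul]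
        congr 2
        · rw [div_mul_div_cancel₀ ht.ne', div_self hst.ne', one_smul]
        · rw [div_mul_cancel₀ _ ht.ne']
      rw [h1, hz, ratPoint_neg]
      module

theorem eq_zero_or_neg_of_mem_cone {X : Set (Fin m → ℚ)} {f : (Fin m → ℝ) →ₗ[ℝ] ℝ}
    (hf : ∀ g ∈ X, f (ratPoint g) < 0) {x : Fin m → ℝ} (hx : x ∈ cone X) : x = 0 ∨ f x < 0 := by
  induction hx using Submodule.span_induction with
  | mem _ h =>
    obtain ⟨g, hg, rfl⟩ := h
    exact .inr (hf g hg)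
  | zero => exact .inl rfl
  | add x y _ _ hx hy =>
    rcases hx with rfl | hx
    · simpa using hy
    · rcases hy with rfl | hy
      · exact .inr (by simpa using hx)
      · exact .inr (by rw [map_add]; linarith)
  | smul c x _ hx =>
    rcases hx with rfl | hx
    · exact .inl (smul_zero _)
    · rcases (zero_le (a := c)).eq_or_lt with rfl | hc
      · exact .inl (zero_smul _ _)
      · right
        rw [NNReal.smul_def, map_smul, smul_eq_mul]
        exact mul_neg_of_pos_of_neg (by exact_mod_cast hc) hx

/-- The functional `f` exposes the ray generated by `d` in the cone generated by `X`. -/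
def Exposes (X : Set (Fin m → ℚ)) (d : Fin m → ℚ) (f : StrongDual ℝ (Fin m → ℝ)) : Prop :=
  f (ratPoint d) = 0 ∧ ∀ g ∈ X, g ≠ d → f (ratPoint g) < 0

theorem Exposes.setOf_eq_ray {X : Set (Fin m → ℚ)} {d : Fin m → ℚ}
    {f : StrongDual ℝ (Fin m → ℝ)} (hf : Exposes X d f) (hd : d ∈ X) (v : Fin m → ℝ) :
    {x ∈ shift v (cone X) | ∀ y ∈ shift v (cone X), f y ≤ f x} = ray v d := by
  have hX : X = insert d (X \ {d}) := by simp [Set.insert_eq_of_mem hd]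
  have key : ∀ n ∈ cone (X \ {d}), n = 0 ∨ f n < 0 := fun n hn =>
    eq_zero_or_neg_of_mem_cone (f := f.toLinearMap) (fun g hg => hf.2 g hg.1 hg.2) hn
  ext x
  constructor
  · rintro ⟨hx, hmax⟩
    have h1 := hmax v (self_mem_shift _ _)
    rw [mem_shift, hX, mem_cone_insert] at hx
    obtain ⟨c, hc, n, hn, hx⟩ := hx
    have h2 : f x - f v = f n := by
      rw [← map_sub, hx, map_add, map_smul, hf.1, smul_zero, zero_add]
    rcases key n hn with rfl | hneg
    · exact ⟨c, hc, by rw [add_zero] at hx; rw [← hx]; abel⟩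
    · linarith
  · rintro ⟨t, ht, rfl⟩
    refine ⟨?_, fun y hy => ?_⟩
    · rw [mem_shift, add_sub_cancel_left]
      exact smul_mem_of_nonneg ht (mem_cone_of_mem hd)
    · rw [mem_shift, hX, mem_cone_insert] at hy
      obtain ⟨c, hc, n, hn, hy⟩ := hy
      have h2 : f y - f v = f n := by
        rw [← map_sub, hy, map_add, map_smul, hf.1, smul_zero, zero_add]
      have h3 : f n ≤ 0 := by
        rcases key n hn with rfl | hneg
        · rw [map_zero]
        · exact hneg.le
      rw [map_add, map_smul, hf.1, smul_zero]
      linarith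

theorem vectorSpan_ray (v : Fin m → ℝ) (d : Fin m → ℚ) :
    vectorSpan ℝ (ray v d) = Submodule.span ℝ {ratPoint d} := by
  apply le_antisymm
  · rw [vectorSpan_def, Submodule.span_le]
    rintro _ ⟨_, ⟨s, -, rfl⟩, _, ⟨t, -, rfl⟩, rfl⟩
    refine Submodule.mem_span_singleton.2 ⟨s - t, ?_⟩
    simp only [vsub_eq_sub]
    module
  · rw [Submodule.span_singleton_le_iff_mem]
    have := vsub_mem_vectorSpan ℝ (s := ray v d) (p₁ := v + (1 : ℝ) • ratPoint d) (p₂ := v)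
      ⟨1, zero_le_one, rfl⟩ ⟨0, le_rfl, by simp⟩
    simpa using this

theorem Exposes.isEdge {X : Set (Fin m → ℚ)} {d : Fin m → ℚ} {f : StrongDual ℝ (Fin m → ℝ)}
    (hf : Exposes X d f) (hd : d ∈ X) (hd0 : d ≠ 0) (v : Fin m → ℝ) :
    IsEdge (shift v (cone X)) (ray v d) := by
  refine ⟨fun _ => ⟨f, (hf.setOf_eq_ray hd v).symm⟩, ?_⟩
  rw [vectorSpan_ray, finrank_span_singleton]
  rw [← ratPoint_zero]
  exact ratPoint_injective.ne hd0

theorem nonpos_of_mem_cone {X : Set (Fin m → ℚ)} {f : (Fin m → ℝ) →ₗ[ℝ] ℝ}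
    (hf : ∀ g ∈ X, f (ratPoint g) ≤ 0) {x : Fin m → ℝ} (hx : x ∈ cone X) : f x ≤ 0 := by
  induction hx using Submodule.span_induction with
  | mem _ h =>
    obtain ⟨g, hg, rfl⟩ := h
    exact hf g hg
  | zero => rw [map_zero]
  | add x y _ _ hx hy => rw [map_add]; linarith
  | smul c x _ hx =>
    rw [NNReal.smul_def, map_smul, smul_eq_mul]
    exact mul_nonpos_of_nonneg_of_nonpos c.2 hx

theorem exists_eq_smul_of_finrank_eq_one {u : Set (Fin m → ℝ)} {v : Fin m → ℝ}
    {d g : Fin m → ℚ} (hu : Module.finrank ℝ (vectorSpan ℝ u) = 1) (hv : v ∈ u)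
    (hd : v + ratPoint d ∈ u) (hg : v + ratPoint g ∈ u) (hd0 : ratPoint d ≠ 0) :
    ∃ c : ℝ, ratPoint g = c • ratPoint d := by
  have h1 : ratPoint d ∈ vectorSpan ℝ u := by
    simpa using vsub_mem_vectorSpan ℝ hd hv
  have h2 : ratPoint g ∈ vectorSpan ℝ u := by
    simpa using vsub_mem_vectorSpan ℝ hg hv
  obtain ⟨c, hc⟩ := (finrank_eq_one_iff_of_nonzero' (⟨_, h1⟩ : vectorSpan ℝ u)
    (fun h => hd0 (congrArg Subtype.val h))).1 hu ⟨_, h2⟩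
  exact ⟨c, (congrArg Subtype.val hc).symm⟩

/-! ### Edges outside the hyperplane -/

section Edges

variable {v : Fin m → ℝ} {Z P : Finset (Fin m → ℚ)} {ℓ : (Fin m → ℝ) →ₗ[ℝ] ℝ}

/-- A functional exposing u vanishes on every generator that occurs in a point of u outside β, and
one of these is in P. Since u is one-dimensional, any other generator with f = 0 is a multiple of d;
the values 0 and 1 of ℓ exclude all but d itself. -/
theorem exists_exposes_of_isEdge (hZ0 : 0 ∉ Z) (hZ : ∀ g ∈ Z, ℓ (ratPoint g) = 0)
    (hP : ∀ g ∈ P, ℓ (ratPoint g) = 1) {u : Set (Fin m → ℝ)}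
    (hu : IsEdge (shift v (cone (Z ∪ P : Set (Fin m → ℚ)))) u) (huβ : ¬ u ⊆ {x | ℓ x = ℓ v}) :
    ∃ d ∈ P, (∃ f, Exposes (Z ∪ P) d f) ∧ u = ray v d := by
  classical
  obtain ⟨hexp, hrank⟩ := hu
  obtain ⟨x₁, hx₁u, hx₁⟩ := Set.not_subset.1 huβ
  obtain ⟨f, hf⟩ := hexp ⟨x₁, hx₁u⟩
  rw [hf] at hx₁u
  obtain ⟨hx₁C, hmax⟩ := hx₁u
  have hneg : ∀ n ∈ cone (Z ∪ P : Set (Fin m → ℚ)), f n ≤ 0 := by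
    intro n hn
    have := hmax (x₁ + n) (by
      rw [mem_shift, add_sub_right_comm]
      exact add_mem hx₁C hn)
    rw [map_add] at this
    linarith
  have hx₁v : f (x₁ - v) = 0 := by
    refine le_antisymm (hneg _ hx₁C) ?_
    have := hmax v (self_mem_shift _ _)
    rw [map_sub]
    linarith
  have hfx : f x₁ = f v := by rw [map_sub] at hx₁v; linarith
  have hmem : ∀ n ∈ cone (Z ∪ P : Set (Fin m → ℚ)), f n = 0 → v + n ∈ u := by
    intro n hn h0
    rw [hf]
    refine ⟨by rwa [mem_shift, add_sub_cancel_left], fun y hy => ?_⟩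
    rw [map_add, h0, add_zero, ← hfx]
    exact hmax y hy
  obtain ⟨d, hdP, hfd⟩ : ∃ d ∈ P, f (ratPoint d) = 0 := by
    by_contra! hne
    have h1 := mem_shift.1 hx₁C
    rw [cone, ← Finset.coe_union, mem_span_image_finset] at h1
    obtain ⟨α, hα, h1⟩ := h1
    have hgn : ∀ g ∈ Z ∪ P, f (ratPoint g) ≤ 0 := fun g hg =>
      hneg _ (mem_cone_of_mem (by simpa using hg))
    have h2 : ∀ g ∈ Z ∪ P, α g * f (ratPoint g) = 0 := by
      rw [h1, map_sum] at hx₁v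
      simp only [map_smul, smul_eq_mul] at hx₁v
      exact (Finset.sum_eq_zero_iff_of_nonpos fun g hg =>
        mul_nonpos_of_nonneg_of_nonpos (hα g hg) (hgn g hg)).1 hx₁v
    apply hx₁
    have h3 : ℓ (x₁ - v) = 0 := by
      rw [h1, map_sum]
      refine Finset.sum_eq_zero fun g hg => ?_
      rw [map_smul, smul_eq_mul]
      by_cases hgP : g ∈ P
      · rw [(mul_eq_zero.1 (h2 g hg)).resolve_right (hne g hgP), zero_mul]
      · rw [hZ g ((Finset.mem_union.1 hg).resolve_right hgP), mul_zero]
    rw [map_sub] at h3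
    exact sub_eq_zero.1 h3
  have hd0 : ratPoint d ≠ 0 := fun h => by simpa [h] using hP d hdP
  have hdX : d ∈ (Z ∪ P : Set (Fin m → ℚ)) := .inr hdP
  have hexposes : Exposes (Z ∪ P) d f := by
    refine ⟨hfd, fun g hg hgd => (hneg _ (mem_cone_of_mem hg)).lt_of_ne fun h0 => hgd ?_⟩
    have hvu : v ∈ u := by simpa using hmem 0 (zero_mem _) (map_zero _)
    obtain ⟨c, hc⟩ := exists_eq_smul_of_finrank_eq_one hrank hvu
      (hmem _ (mem_cone_of_mem hdX) hfd) (hmem _ (mem_cone_of_mem hg) h0) hd0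
    have hlc : ℓ (ratPoint g) = c := by rw [hc, map_smul, hP d hdP, smul_eq_mul, mul_one]
    apply ratPoint_injective
    rcases hg with hg | hg
    · exfalso
      rw [hZ g hg] at hlc
      rw [← hlc, zero_smul, ← ratPoint_zero] at hc
      exact hZ0 (ratPoint_injective hc ▸ hg)
    · rw [hP g hg] at hlc
      rw [hc, ← hlc, one_smul]
  exact ⟨d, hdP, ⟨f, hexposes⟩, by rw [hf, hexposes.setOf_eq_ray hdX]⟩

/-- The projection n ↦ n - ℓ(n) d along d fixes Z and sends P to P - d. It gives -s d + n = (ℓ(n) -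
s) d + (n - ℓ(n) d), and membership in the half-space says that ℓ(n) - s ≥ 0. -/
theorem shift_cone_insert_neg_inter (hZ : ∀ g ∈ Z, ℓ (ratPoint g) = 0)
    (hP : ∀ g ∈ P, ℓ (ratPoint g) = 1) {d : Fin m → ℚ} (hd : d ∈ P) :
    shift v (cone (insert (-d) (Z ∪ P))) ∩ {x | ℓ v ≤ ℓ x} =
      shift v (cone (insert d (Z ∪ (fun g => g - d) '' (P : Set (Fin m → ℚ))))) := by
  ext x
  constructor
  · rintro ⟨hx, hxD⟩
    obtain ⟨s, hs, n, hn, hx⟩ := mem_cone_insert.1 hx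
    have hℓ : 0 ≤ ℓ n - s := by
      have : ℓ (x - v) = ℓ n - s := by
        rw [hx, map_add, map_smul, ratPoint_neg, map_neg, hP d hd, smul_eq_mul]
        ring
      rw [map_sub] at this
      rw [← this]
      exact sub_nonneg.2 hxD
    have hproj : ∀ n ∈ cone (Z ∪ P : Set (Fin m → ℚ)), n - ℓ n • ratPoint d ∈
        cone (Z ∪ (fun g => g - d) '' (P : Set (Fin m → ℚ))) := by
      intro n hn
      induction hn using Submodule.span_induction with
      | mem _ h =>
        obtain ⟨g, hg | hg, rfl⟩ := h
        · rw [hZ g hg, zero_smul, sub_zero]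
          exact mem_cone_of_mem (.inl hg)
        · rw [hP g hg, one_smul, ← ratPoint_sub]
          exact mem_cone_of_mem (.inr ⟨g, hg, rfl⟩)
      | zero => simp
      | add x y _ _ hx hy =>
        have : x + y - ℓ (x + y) • ratPoint d =
            (x - ℓ x • ratPoint d) + (y - ℓ y • ratPoint d) := by
          rw [map_add]
          module
        rw [this]
        exact add_mem hx hy
      | smul c x _ hx =>
        have : c • x - ℓ (c • x) • ratPoint d = (c : ℝ) • (x - ℓ x • ratPoint d) := by
          rw [NNReal.smul_def, map_smul, smul_eq_mul]
          module
        rw [this]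
        exact smul_mem_of_nonneg c.2 hx
    rw [mem_shift, mem_cone_insert]
    refine ⟨ℓ n - s, hℓ, _, hproj n hn, ?_⟩
    rw [hx, ratPoint_neg]
    module
  · intro hx
    have hle : cone (insert d (Z ∪ (fun g => g - d) '' (P : Set (Fin m → ℚ)))) ≤
        cone (insert (-d) (Z ∪ P)) := by
      refine cone_le.2 ?_
      rintro g (rfl | hg | ⟨g, hg, rfl⟩)
      · exact mem_cone_of_mem (.inr (.inr hd))
      · exact mem_cone_of_mem (.inr (.inl hg))
      · beta_reduce
        rw [sub_eq_add_neg, ratPoint_add]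
        exact add_mem (mem_cone_of_mem (.inr (.inr hg))) (mem_cone_of_mem (.inl rfl))
    refine ⟨hle hx, ?_⟩
    have h1 : (-ℓ) (x - v) ≤ 0 := by
      refine nonpos_of_mem_cone ?_ hx
      rintro g (rfl | hg | ⟨g, hg, rfl⟩)
      · rw [LinearMap.neg_apply, hP g hd]
        norm_num
      · rw [LinearMap.neg_apply, hZ g hg, neg_zero]
      · beta_reduce
        rw [LinearMap.neg_apply, ratPoint_sub, map_sub, hP g hg, hP d hd]
        norm_num
    rw [LinearMap.neg_apply, map_sub] at h1
    rw [Set.mem_ofPred_eq]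
    linarith

/-- A finite set of nonzero vectors is positive for some functional, or its cone contains a line
through one of the vectors. -/
theorem exists_pos_or_neg_mem_cone (Y : Finset (Fin m → ℚ)) :
    (∃ f : StrongDual ℝ (Fin m → ℝ), ∀ y ∈ Y, 0 < f (ratPoint y)) ∨
      ∃ y ∈ Y, -ratPoint y ∈ cone (Y : Set (Fin m → ℚ)) := by
  classical
  -- Gordan's alternative: either 0 is a convex combination of Y, or it is strictly separated from
  -- the hull.
  by_cases h0 : (0 : Fin m → ℝ) ∈ convexHull ℝ ((Y.image ratPoint : Finset (Fin m → ℝ)) : Set _)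
  · right
    obtain ⟨w, hw, hw1, hw0⟩ := Finset.mem_convexHull'.1 h0
    rw [Finset.sum_image ratPoint_injective.injOn] at hw1 hw0
    obtain ⟨y, hy, hwy⟩ : ∃ y ∈ Y, 0 < w (ratPoint y) := by
      by_contra! hle
      linarith [Finset.sum_nonpos hle]
    refine ⟨y, hy, ?_⟩
    rw [← Finset.add_sum_erase _ _ hy] at hw0
    have h1 : -ratPoint y =
        (w (ratPoint y))⁻¹ • ∑ g ∈ Y.erase y, w (ratPoint g) • ratPoint g := by
      rw [eq_inv_smul_iff₀ hwy.ne', smul_neg]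
      exact neg_eq_of_add_eq_zero_right hw0
    rw [h1]
    refine smul_mem_of_nonneg (inv_nonneg.2 hwy.le) (sum_mem fun g hg => ?_)
    have hgY := Finset.mem_of_mem_erase hg
    exact smul_mem_of_nonneg (hw _ (Finset.mem_image_of_mem _ hgY)) (mem_cone_of_mem hgY)
  · left
    obtain ⟨f, u, hu, hf⟩ := geometric_hahn_banach_point_closed (convex_convexHull ℝ _)
      ((Finset.finite_toSet _).isClosed_convexHull ℝ) h0
    rw [map_zero] at hu
    exact ⟨f, fun y hy => hu.trans (hf _ (subset_convexHull ℝ _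
      (Finset.mem_coe.2 (Finset.mem_image_of_mem _ hy))))⟩

theorem coneSigma_eq_zero_of_not_exposes (hZ0 : 0 ∉ Z) (hZ : ∀ g ∈ Z, ℓ (ratPoint g) = 0)
    (hP : ∀ g ∈ P, ℓ (ratPoint g) = 1) {d : Fin m → ℚ} (hd : d ∈ P)
    (hdf : ¬ ∃ f, Exposes (Z ∪ P) d f) :
    coneSigma v (insert d (Z ∪ (fun g => g - d) '' (P : Set (Fin m → ℚ)))) = 0 := by
  classical
  rcases exists_pos_or_neg_mem_cone (Z ∪ (P.erase d).image fun g => g - d) with ⟨f, hf⟩ | h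
  -- For f positive on Z and on the g - d with g ≠ d, the functional f(d) ℓ - f is 0 at d, -f on Z,
  -- and f(d) - f(g) < 0 at the other g in P.
  · refine absurd ⟨f (ratPoint d) •
      (LinearMap.toContinuousLinearMap ℓ : StrongDual ℝ (Fin m → ℝ)) - f, ?_, ?_⟩ hdf
    · simp [hP d hd]
    · intro g hg hgd
      simp only [sub_apply, smul_apply,
        LinearMap.coe_toContinuousLinearMap', smul_eq_mul]
      rcases hg with hg | hg
      · have := hf g (Finset.mem_union_left _ hg)
        rw [hZ g hg]
        linarith
      · have := hf (g - d) (Finset.mem_union_right _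
          (Finset.mem_image_of_mem _ (Finset.mem_erase.2 ⟨hgd, hg⟩)))
        rw [ratPoint_sub, map_sub] at this
        rw [hP g hg]
        linarith
  · obtain ⟨y, hy, hyn⟩ := h
    have hsub : ((Z ∪ (P.erase d).image fun g => g - d : Finset (Fin m → ℚ)) : Set (Fin m → ℚ)) ⊆
        insert d (Z ∪ (fun g => g - d) '' (P : Set (Fin m → ℚ))) := by
      rw [Finset.coe_union, Finset.coe_image]
      exact (Set.union_subset_union_right _ (Set.image_mono (by simp))).trans
        (Set.subset_insert _ _)
    refine coneSigma_eq_zero (a := y) ?_ (mem_cone_of_mem (hsub hy)) (cone_mono hsub hyn)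
    rintro rfl
    rcases Finset.mem_union.1 hy with hy | hy
    · exact hZ0 hy
    · obtain ⟨g, hg, hgd⟩ := Finset.mem_image.1 hy
      exact (Finset.mem_erase.1 hg).1 (sub_eq_zero.1 hgd)

theorem sigma_eq_sum_edges (hZ0 : 0 ∉ Z) (hZ : ∀ g ∈ Z, ℓ (ratPoint g) = 0)
    (hP : ∀ g ∈ P, ℓ (ratPoint g) = 1) (hPne : P.Nonempty) {C β D : Set (Fin m → ℝ)}
    (hC : C = shift v (cone (Z ∪ P))) (hβ : β = {x | ℓ x = ℓ v}) (hD : D = {x | ℓ v ≤ ℓ x}) :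
    HasSigma C ∧
      (∀ u, IsEdge C u → ¬ u ⊆ β → HasSigma (coneAt C u ∩ D)) ∧
      ∃ hfin : {u : Set (Fin m → ℝ) | IsEdge C u ∧ ¬ u ⊆ β}.Finite,
        sigma C = ∑ u ∈ hfin.toFinset, sigma (coneAt C u ∩ D) := by
  classical
  subst hC hβ hD
  have hd0 : ∀ d ∈ P, ratPoint d ≠ 0 := fun d hd h => by simpa [h] using hP d hd
  have hd0' : ∀ d ∈ P, d ≠ 0 := fun d hd h => hd0 d hd (by rw [h, ratPoint_zero])
  have hcone : ∀ d ∈ P, coneAt (shift v (cone (Z ∪ P))) (ray v d) ∩ {x | ℓ v ≤ ℓ x} =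
      shift v (cone (insert d (Z ∪ (fun g => g - d) '' (P : Set (Fin m → ℚ))))) := fun d hd => by
    rw [coneAt_ray v (.inr hd) (hd0' d hd), shift_cone_insert_neg_inter hZ hP hd]
  have hfinite : ∀ d, (insert d (Z ∪ (fun g => g - d) '' (P : Set (Fin m → ℚ))) :
      Set (Fin m → ℚ)).Finite :=
    fun d => (Z.finite_toSet.union (P.finite_toSet.image _)).insert d
  have hedges : {u : Set (Fin m → ℝ) | IsEdge (shift v (cone (Z ∪ P))) u ∧
      ¬ u ⊆ {x | ℓ x = ℓ v}} =
      ((P.filter fun d => ∃ f, Exposes (Z ∪ P) d f).image (ray v) : Finset _) := by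
    ext u
    simp only [Set.mem_ofPred_eq, Finset.coe_image, Finset.coe_filter, Set.mem_image]
    constructor
    · rintro ⟨hu, huβ⟩
      obtain ⟨d, hd, hf, rfl⟩ := exists_exposes_of_isEdge hZ0 hZ hP hu huβ
      exact ⟨d, ⟨hd, hf⟩, rfl⟩
    · rintro ⟨d, ⟨hd, f, hf⟩, rfl⟩
      refine ⟨hf.isEdge (.inr hd) (hd0' d hd) v, fun h => ?_⟩
      have := h (show v + (1 : ℝ) • ratPoint d ∈ ray v d from ⟨1, zero_le_one, rfl⟩)
      rw [Set.mem_ofPred_eq, one_smul, map_add, hP d hd] at this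
      linarith
  refine ⟨hasSigma_cone v (Z.finite_toSet.union P.finite_toSet), ?_, ?_⟩
  · intro u hu huβ
    obtain ⟨d, hd, -, rfl⟩ := exists_exposes_of_isEdge hZ0 hZ hP hu huβ
    rw [hcone d hd]
    exact hasSigma_cone v (hfinite d)
  · rw [hedges]
    refine ⟨Finset.finite_toSet _, ?_⟩
    rw [Finset.finite_toSet_toFinset, Finset.sum_image]
    · change coneSigma v _ = _
      rw [coneSigma_eq_sum v P hPne Z Z.finite_toSet, Finset.sum_filter]
      refine Finset.sum_congr rfl fun d hd => ?_
      split_ifs with h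
      · rw [hcone d hd]
        rfl
      · exact coneSigma_eq_zero_of_not_exposes hZ0 hZ hP hd h
    -- Different d give different rays, because ℓ(d) = 1 singles out d among its positive multiples.
    · intro d hd e he h
      have hdP := (Finset.mem_filter.1 hd).1
      have heP := (Finset.mem_filter.1 he).1
      obtain ⟨t, ht, h1⟩ : v + (1 : ℝ) • ratPoint d ∈ ray v e := by
        rw [← h]
        exact ⟨1, zero_le_one, rfl⟩
      have h2 := add_left_cancel h1
      have h3 := congrArg ℓ h2
      rw [map_smul, map_smul, hP d hdP, hP e heP, smul_eq_mul, smul_eq_mul, mul_one, mul_one] at h3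
      rw [← h3, one_smul, one_smul] at h2
      exact ratPoint_injective h2

end Edges

/-! ### Normalized generators and the half-space -/

/-- The linear functional with the given coefficients. -/
def dotLin (a : Fin m → ℝ) : (Fin m → ℝ) →ₗ[ℝ] ℝ :=
  ∑ i, a i • LinearMap.proj i

theorem dotLin_apply (a x : Fin m → ℝ) : dotLin a x = ∑ i, a i * x i := by
  simp [dotLin, LinearMap.sum_apply]

theorem exists_normalized_generators {a : Fin m → ℚ} {G : Finset (Fin m → ℚ)}
    (hG : ∀ g ∈ G, 0 ≤ ∑ i, a i * g i) :
    ∃ Z P : Finset (Fin m → ℚ), 0 ∉ Z ∧ (∀ g ∈ Z, dotLin (ratPoint a) (ratPoint g) = 0) ∧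
      (∀ g ∈ P, dotLin (ratPoint a) (ratPoint g) = 1) ∧
      cone (G : Set (Fin m → ℚ)) = cone (Z ∪ P) := by
  classical
  have hdot : ∀ g, dotLin (ratPoint a) (ratPoint g) = ((∑ i, a i * g i : ℚ) : ℝ) := by
    intro g
    simp [dotLin_apply, ratPoint]
  refine ⟨(G.filter fun g => ∑ i, a i * g i = 0).erase 0,
    (G.filter fun g => 0 < ∑ i, a i * g i).image fun g => (∑ i, a i * g i)⁻¹ • g,
    Finset.notMem_erase _ _, ?_, ?_, le_antisymm (cone_le.2 ?_) (cone_le.2 ?_)⟩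
  · intro g hg
    rw [hdot, (Finset.mem_filter.1 (Finset.mem_of_mem_erase hg)).2, Rat.cast_zero]
  · intro g hg
    obtain ⟨g, hg', rfl⟩ := Finset.mem_image.1 hg
    have h := (Finset.mem_filter.1 hg').2
    rw [ratPoint_smul, map_smul, hdot, smul_eq_mul, ← Rat.cast_mul, inv_mul_cancel₀ h.ne',
      Rat.cast_one]
  · intro g hg
    rcases (hG g hg).eq_or_lt with h | h
    · by_cases hg0 : g = 0
      · rw [hg0, ratPoint_zero]
        exact zero_mem _
      · exact mem_cone_of_mem (.inl (Finset.mem_erase.2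
          ⟨hg0, Finset.mem_filter.2 ⟨hg, h.symm⟩⟩))
    · have h1 : ratPoint g = ((∑ i, a i * g i : ℚ) : ℝ) •
          ratPoint ((∑ i, a i * g i)⁻¹ • g) := by
        rw [← ratPoint_smul, smul_inv_smul₀ h.ne']
      rw [h1]
      exact smul_mem_of_nonneg (by exact_mod_cast h.le) (mem_cone_of_mem
        (.inr (Finset.mem_coe.2 (Finset.mem_image_of_mem _ (Finset.mem_filter.2 ⟨hg, h⟩)))))
  · rintro g (hg | hg)
    · exact mem_cone_of_mem (Finset.mem_filter.1 (Finset.mem_of_mem_erase hg)).1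
    · obtain ⟨g, hg', rfl⟩ := Finset.mem_image.1 hg
      obtain ⟨hg, h⟩ := Finset.mem_filter.1 hg'
      rw [ratPoint_smul]
      exact smul_mem_of_nonneg (by exact_mod_cast (inv_pos.2 h).le) (mem_cone_of_mem hg)

/-- Two equations of one hyperplane are proportional, and the point x₀ off it fixes the sign of the
factor. -/
theorem IsHalfSpaceOf.eq_of_subset {ℓ : (Fin m → ℝ) →ₗ[ℝ] ℝ} {v x₀ : Fin m → ℝ}
    {D : Set (Fin m → ℝ)} (hD : IsHalfSpaceOf {x | ℓ x = ℓ v} D) (hx₀D : x₀ ∈ D)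
    (hx₀ : ℓ v < ℓ x₀) : D = {x | ℓ v ≤ ℓ x} := by
  obtain ⟨a, b, -, hβ, rfl⟩ := hD
  simp only [← dotLin_apply] at *
  have hiff : ∀ x, ℓ x = ℓ v ↔ dotLin a x = b := fun x => by
    exact Set.ext_iff.1 hβ x
  have h0 : 0 < ℓ x₀ - ℓ v := sub_pos.2 hx₀
  have hb : dotLin a v = b := (hiff v).1 rfl
  have h1 : 0 < dotLin a x₀ - b :=
    sub_pos.2 (lt_of_le_of_ne hx₀D fun h => hx₀.ne' ((hiff x₀).2 h.symm))
  ext x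
  have h2 : dotLin a x - b = (ℓ x - ℓ v) / (ℓ x₀ - ℓ v) * (dotLin a x₀ - b) := by
    -- Moving x parallel to x₀ - v onto the hyperplane compares the two functionals at x.
    have h3 := (hiff (x - ((ℓ x - ℓ v) / (ℓ x₀ - ℓ v)) • (x₀ - v))).1 (by
      rw [map_sub, map_smul, map_sub, smul_eq_mul, div_mul_cancel₀ _ h0.ne']
      ring)
    rw [map_sub, map_smul, map_sub, smul_eq_mul, hb] at h3
    linarith
  rw [Set.mem_ofPred_eq, Set.mem_ofPred_eq, ← sub_nonneg, h2, mul_nonneg_iff_of_pos_right h1,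
    le_div_iff₀ h0, zero_mul, sub_nonneg]

end RatCone

end

theorem mainTheorem5 {m : ℕ} (v : Fin m → ℝ) (C β : Set (Fin m → ℝ))
    (hC : RatCone.IsRationalCone v C)
    (hβ : RatCone.IsRationalHyperplane β)
    (hv : v ∈ β)
    (hint : Disjoint β (intrinsicInterior ℝ C)) :
    (∃! D : Set (Fin m → ℝ), RatCone.IsHalfSpaceOf β D ∧ C ⊆ D) ∧
    ∀ D : Set (Fin m → ℝ), RatCone.IsHalfSpaceOf β D → C ⊆ D →
      RatCone.HasSigma C ∧
      (∀ u, RatCone.IsEdge C u → ¬ u ⊆ β → RatCone.HasSigma (RatCone.coneAt C u ∩ D)) ∧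
      ∃ hfin : {u : Set (Fin m → ℝ) | RatCone.IsEdge C u ∧ ¬ u ⊆ β}.Finite,
        RatCone.sigma C =
          ∑ u ∈ hfin.toFinset, RatCone.sigma (RatCone.coneAt C u ∩ D) := by
  open RatCone in
  obtain ⟨-, G, hG⟩ := hC
  have hC : C = shift v (cone (G : Set (Fin m → ℚ))) := by
    rw [hG]
    ext x
    rw [mem_shift, cone, mem_span_image_finset]
    simp only [Set.mem_ofPred_eq, sub_eq_iff_eq_add']
  clear hG
  have hconv : Convex ℝ C := hC ▸ convex_shift v _
  have hvC : v ∈ C := hC ▸ self_mem_shift v _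
  obtain ⟨x₀, hx₀⟩ := Set.Nonempty.intrinsicInterior hconv ⟨v, hvC⟩
  have hx₀C : x₀ ∈ C := intrinsicInterior_subset hx₀
  obtain ⟨a, ha, hβa, hpos⟩ : ∃ a : Fin m → ℚ, a ≠ 0 ∧
      β = {x | dotLin (ratPoint a) x = dotLin (ratPoint a) v} ∧
      dotLin (ratPoint a) v < dotLin (ratPoint a) x₀ := by
    obtain ⟨a, b, ha, rfl⟩ := hβ
    have hne : dotLin (ratPoint a) x₀ ≠ dotLin (ratPoint a) v := fun h =>
      Set.disjoint_right.1 hint hx₀ (by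
        rw [dotLin_apply, dotLin_apply] at h
        exact h.trans hv)
    have hβa : {x : Fin m → ℝ | ∑ i, (a i : ℝ) * x i = (b : ℝ)} =
        {x | dotLin (ratPoint a) x = dotLin (ratPoint a) v} := by
      ext x
      rw [Set.mem_ofPred_eq, Set.mem_ofPred_eq, dotLin_apply, dotLin_apply]
      exact ⟨fun h => h.trans hv.symm, fun h => h.trans hv⟩
    -- The sign of a is chosen so that x₀ lies on the positive side.
    rcases hne.lt_or_gt with h | h
    · have hneg : ∀ x, dotLin (ratPoint (-a)) x = -dotLin (ratPoint a) x := by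
        intro x
        simp [dotLin_apply, ratPoint]
      refine ⟨-a, neg_ne_zero.2 ha, ?_, ?_⟩
      · simp only [hneg, neg_inj]
        exact hβa
      · rw [hneg, hneg]
        exact neg_lt_neg h
    · exact ⟨a, ha, hβa, h⟩
  subst hβa
  have hCD : C ⊆ {x | dotLin (ratPoint a) v ≤ dotLin (ratPoint a) x} := fun y hy =>
    le_of_disjoint_intrinsicInterior hconv _ hint hx₀ hpos hy
  have hhalf : IsHalfSpaceOf {x | dotLin (ratPoint a) x = dotLin (ratPoint a) v}
      {x | dotLin (ratPoint a) v ≤ dotLin (ratPoint a) x} := by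
    refine ⟨ratPoint a, dotLin (ratPoint a) v, ?_, ?_, ?_⟩
    · rw [← ratPoint_zero]
      exact ratPoint_injective.ne ha
    · simp only [dotLin_apply]
    · simp only [dotLin_apply]
  have huniq : ∀ D, IsHalfSpaceOf {x | dotLin (ratPoint a) x = dotLin (ratPoint a) v} D →
      C ⊆ D → D = {x | dotLin (ratPoint a) v ≤ dotLin (ratPoint a) x} := fun D hD hsub =>
    hD.eq_of_subset (hsub hx₀C) hpos
  refine ⟨⟨_, ⟨hhalf, hCD⟩, fun D hD => huniq D hD.1 hD.2⟩, fun D hD hsub => ?_⟩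
  have hGpos : ∀ g ∈ G, 0 ≤ ∑ i, a i * g i := by
    intro g hg
    have h1 : v + ratPoint g ∈ C := by
      rw [hC, mem_shift, add_sub_cancel_left]
      exact mem_cone_of_mem hg
    have h2 := hCD h1
    rw [Set.mem_ofPred_eq, map_add, le_add_iff_nonneg_right, dotLin_apply] at h2
    simp only [ratPoint] at h2
    exact_mod_cast h2
  obtain ⟨Z, P, hZ0, hZ, hP, hZP⟩ := exists_normalized_generators hGpos
  rw [hZP] at hC
  refine sigma_eq_sum_edges hZ0 hZ hP ?_ hC rfl (huniq D hD hsub)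
  -- If P were empty, C would lie in β, contradicting the position of x₀.
  rw [Finset.nonempty_iff_ne_empty]
  rintro rfl
  have h1 : dotLin (ratPoint a) (x₀ - v) ≤ 0 := by
    refine nonpos_of_mem_cone (X := Z ∪ (∅ : Finset (Fin m → ℚ))) ?_
      (mem_shift.1 (hC ▸ hx₀C))
    rintro g (hg | hg)
    · exact (hZ g hg).le
    · simp at hg
  rw [map_sub] at h1
  linarith
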